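/- **Theorem.** Let $E$ and $F$ be measurable spaces in which all singletons are measurable (for example $\mathbb{R}^p$ and $\mathbb{R}^q$), and let $d_X : E\times E\to\mathbb{R}$ and $d_Y : F\times F\to\mathbb{R}$ be either both metrics of strong negative type or both characteristic kernels. Let $X$ and $Y$ be independent binary random variables with values in $E$ and $F$, that is, each of them takes exactly two distinct values, both with positive probability. Let $(x_1,y_1),(x_2,y_2),\dots$ be independent random pairs with the same distribution as $(X,Y)$, and put $\mathbf{X}=(x_1,\dots,x_n)$, $\mathbf{Y}=(y_1,\dots,y_n)$. Then $$ n\,\mathrm{Dcor}_n(\mathbf{X},\mathbf{Y}) \xrightarrow{\;D\;} U \qquad (n\to\infty), $$ where $U$ has the centered chi-square distribution $\chi^2_1-1$, the law of $N^2-1$ for a standard normal $N$. Here $\mathrm{Dcor}_n$ is the bias-corrected sample distance correlation: with $\mathbf{D}^{\mathbf{X}}_{ij}=d_X(x_i,x_j)$, put $\mathbf{C}^{\mathbf{X}}_{ii}=0$ and, for $i\ne j$, $$\mathbf{C}^{\mathbf{X}}_{ij}=\mathbf{D}^{\mathbf{X}}_{ij}-\frac1{n-2}\sum_{t=1}^n\mathbf{D}^{\mathbf{X}}_{it}-\frac1{n-2}\sum_{s=1}^n\mathbf{D}^{\mathbf{X}}_{sj}+\frac1{(n-1)(n-2)}\sum_{s,t=1}^n\mathbf{D}^{\mathbf{X}}_{st},$$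 define $\mathbf{C}^{\mathbf{Y}}$ in the same way from $\mathbf{D}^{\mathbf{Y}}_{ij}=d_Y(y_i,y_j)$, and let $$\mathrm{Dcov}_n(\mathbf{X},\mathbf{Y})=\frac{\operatorname{trace}(\mathbf{C}^{\mathbf{X}}\mathbf{C}^{\mathbf{Y}})}{n(n-3)},\qquad \mathrm{Dcor}_n(\mathbf{X},\mathbf{Y})=\frac{\mathrm{Dcov}_n(\mathbf{X},\mathbf{Y})}{\sqrt{\mathrm{Dcov}_n(\mathbf{X},\mathbf{X})\,\mathrm{Dcov}_n(\mathbf{Y},\mathbf{Y})}},$$ with $\mathrm{Dcor}_n(\mathbf{X},\mathbf{Y})=0$ if $n<4$ or if the denominator is not positive. A (measurable) metric $d$ is of *strong negative type* if $\sum_{i,j}\alpha_i\alpha_j d(z_i,z_j)\le 0$ for all finitely many points $z_i$ and reals $\alpha_i$ with $\sum_i\alpha_i=0$, and if any two probability measures $\mu,\nu$ with finite first moment such that $\iint d\,d\mu\,d\mu-2\iint d\,d\mu\,d\nu+\iint d\,d\nu\,d\nu=0$ are equal. A (measurable) symmetric positive semidefinite kernel $k$ is *characteristic* if the mean embedding $\mu\mapsto\int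 k(\cdot,z)\,\mu(dz)$ is injective on the probability measures $\mu$ with $\int\sqrt{k(z,z)}\,\mu(dz)<\infty$. -/

import Mathlib

open MeasureTheory ProbabilityTheory Filter

noncomputable section

namespace DistCorr

/-- `d` is a (measurable) metric on `E` of strong negative type: it satisfies the axioms of a
metric, `∑ α x * α y * d x y ≤ 0` for all finitely supported weights `α` of total mass zero, and two
probability measures `μ`, `ν` with finite first moment such that `∫∫ d(x, y) (μ - ν)(dx) (μ - ν)(dy)`
vanishes are equal. -/
structure IsStrongNegativeTypeMetric {E : Type*} [MeasurableSpace E] (d : E → E → ℝ) : Prop where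
  measurable : Measurable (fun z : E × E => d z.1 z.2)
  self : ∀ x, d x x = 0
  eq_of_eq_zero : ∀ x y, d x y = 0 → x = y
  symm : ∀ x y, d x y = d y x
  triangle : ∀ x y z, d x z ≤ d x y + d y z
  negative_type : ∀ (s : Finset E) (α : E → ℝ), ∑ x ∈ s, α x = 0 →
    ∑ x ∈ s, ∑ y ∈ s, α x * α y * d x y ≤ 0
  strong : ∀ (μ ν : Measure E) [IsProbabilityMeasure μ] [IsProbabilityMeasure ν],
    (∀ o, Integrable (d o) μ) → (∀ o, Integrable (d o) ν) →
    (∫ z, d z.1 z.2 ∂(μ.prod μ)) - 2 * (∫ z, d z.1 z.2 ∂(μ.prod ν))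
      + (∫ z, d z.1 z.2 ∂(ν.prod ν)) = 0 → μ = ν

/-- `k` is a (measurable) characteristic kernel on `E`: it is symmetric and positive semidefinite,
and the kernel mean embedding `μ ↦ ∫ k(·, y) μ(dy)` is injective on the probability measures for
which it is defined, those with `∫ √k(x, x) μ(dx) < ∞` (all of them when `k` is bounded). -/
structure IsCharacteristicKernel {E : Type*} [MeasurableSpace E] (k : E → E → ℝ) : Prop where
  measurable : Measurable (fun z : E × E => k z.1 z.2)
  symm : ∀ x y, k x y = k y x
  posSemidef : ∀ (s : Finset E) (α : E → ℝ), 0 ≤ ∑ x ∈ s, ∑ y ∈ s, α x * α y * k x y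
  embedding_injective : ∀ (μ ν : Measure E) [IsProbabilityMeasure μ] [IsProbabilityMeasure ν],
    Integrable (fun x => Real.sqrt (k x x)) μ → Integrable (fun x => Real.sqrt (k x x)) ν →
    (∀ x, ∫ y, k x y ∂μ = ∫ y, k x y ∂ν) → μ = ν

/-- The `n × n` distance (or kernel) matrix of a sample. -/
def distMatrix {E : Type*} (d : E → E → ℝ) {n : ℕ} (x : Fin n → E) : Matrix (Fin n) (Fin n) ℝ :=
  Matrix.of fun i j => d (x i) (x j)

/-- The bias-corrected centering `C` of an `n × n` matrix `D`. -/
def modifiedMatrix {n : ℕ} (D : Matrix (Fin n) (Fin n) ℝ) : Matrix (Fin n) (Fin n) ℝ :=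
  Matrix.of fun i j =>
    if i = j then 0
    else D i j - 1 / ((n : ℝ) - 2) * ∑ t, D i t - 1 / ((n : ℝ) - 2) * ∑ s, D s j
      + 1 / (((n : ℝ) - 1) * ((n : ℝ) - 2)) * ∑ s, ∑ t, D s t

/-- The bias-corrected sample distance covariance, as a function of the two distance matrices. -/
def dcov {n : ℕ} (A B : Matrix (Fin n) (Fin n) ℝ) : ℝ :=
  1 / ((n : ℝ) * ((n : ℝ) - 3)) * (modifiedMatrix A * modifiedMatrix B).trace

open Classical in
/-- The bias-corrected sample distance correlation of the samples `x` and `y`; it is `0` if `n < 4`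
or if its denominator is not positive. -/
def dcor {E F : Type*} (dX : E → E → ℝ) (dY : F → F → ℝ) {n : ℕ} (x : Fin n → E) (y : Fin n → F) :
    ℝ :=
  if 4 ≤ n ∧ 0 < Real.sqrt (dcov (distMatrix dX x) (distMatrix dX x)
      * dcov (distMatrix dY y) (distMatrix dY y)) then
    dcov (distMatrix dX x) (distMatrix dY y)
      / Real.sqrt (dcov (distMatrix dX x) (distMatrix dX x)
        * dcov (distMatrix dY y) (distMatrix dY y))
  else 0

/-- The random variable `X` is binary: it takes exactly two distinct values, each with positive
probability. -/
def IsBinary {Ω E : Type*} [MeasurableSpace Ω] (X : Ω → E) (P : Measure Ω) : Prop :=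
  ∃ a b : E, a ≠ b ∧ 0 < P {ω | X ω = a} ∧ 0 < P {ω | X ω = b} ∧ ∀ᵐ ω ∂P, X ω = a ∨ X ω = b

/-- The chi-square distribution with one degree of freedom: the law of the square of a standard
normal random variable. -/
def chiSquareOne : Measure ℝ := (gaussianReal 0 1).map (fun z => z ^ 2)

/-- The centered chi-square distribution `χ²₁ - 1`. -/
def centeredChiSquare : Measure ℝ := chiSquareOne.map (fun t => t - 1)

end DistCorr

end

/-!
A function `d` on a two-point set is bi-affine in the indicators: with `u i = 1` if `x i = a` and
`u i = 0` if `x i = b`,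
`d (x i) (x j) = A + B (u i + u j) + G u i u j`, where `G = d a a + d b b - 2 d a b`
(`distMatrix_eq_biaffineMatrix`). Recentering the indicators at their sample mean, `v i = u i - ū`,
the bias-corrected centering turns this matrix, off the diagonal, into `G v i v j` plus terms of
order `1 / n` (`modifiedMatrix_biaffineMatrix`); these contribute a bounded amount to the trace
(`abs_trace_sub_le`), even for kernels, whose diagonal does not vanish. So if `v`, `w` belong to the
two samples,
`n (n - 3) Dcov = G G' ((∑ v w)² - ∑ v² w²) + O(1)`.

The coefficients `G`, `G'` are nonzero and of the same sign: negative for metrics, where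
`G = -2 d a b`, and positive for characteristic kernels, where `G` is the squared distance of the
mean embeddings of the Dirac masses at `a` and `b` (`interaction_mul_pos`). Hence they cancel
against the denominator of `Dcor`. With `s = p (1 - p) q (1 - q)` and `W n = ∑ v w / √(n s)`,
the strong law of large numbers gives `n Dcor = (W n)² R n + r n` with `R n → 1` and `r n → -1` almost surely
(`tendsto_dcor_decomposition`), the limit `-1` being that of `-∑ v² w² / (n s)`. Up to a product
of two deviations of sample means, which is negligible, `W n` is a normalised sum of the independent
centered variables `(u i - p) (z i - q)` with variance `s`. By the central limit theorem it tends to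
a standard normal variable (`tendstoInDistribution_crossSum`), and Slutsky's theorem yields the
limit `N² - 1`.
-/

namespace DistCorr

open Topology

/-! ### Bias-corrected centering for two-point samples -/

/-- The general symmetric matrix of a two-point sample with indicators `u i ∈ {0, 1}`: its entries
are symmetric bi-affine functions of `(u i, u j)`. -/
def biaffineMatrix (A B G : ℝ) {n : ℕ} (u : Fin n → ℝ) : Matrix (Fin n) (Fin n) ℝ :=
  Matrix.of fun i j => A + B * (u i + u j) + G * (u i * u j)

theorem distMatrix_eq_biaffineMatrix {E : Type*} {d : E → E → ℝ} (hd : ∀ x y, d x y = d y x)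
    {a b : E} {n : ℕ} {x : Fin n → E} {u : Fin n → ℝ}
    (h : ∀ i, x i = a ∧ u i = 1 ∨ x i = b ∧ u i = 0) :
    distMatrix d x =
      biaffineMatrix (d b b) (d a b - d b b) (d a a + d b b - 2 * d a b) u := by
  ext i j
  simp only [distMatrix, biaffineMatrix, Matrix.of_apply]
  rcases h i with ⟨h1, h2⟩ | ⟨h1, h2⟩ <;> rcases h j with ⟨h3, h4⟩ | ⟨h3, h4⟩ <;>
    rw [h1, h2, h3, h4]
  · ring
  · ring
  · rw [hd b a]; ring
  · ring

/-- After recentering the indicators at their sample mean `m`, only the product term of a bi-affine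
matrix survives the bias-corrected centering at order one; the other two terms are of
order `1 / n`. -/
theorem modifiedMatrix_biaffineMatrix (A B G : ℝ) {n : ℕ} (hn : 4 ≤ n) (u : Fin n → ℝ) {m : ℝ}
    (hm : ∑ i, u i = n * m) {i j : Fin n} (hij : i ≠ j) :
    modifiedMatrix (biaffineMatrix A B G u) i j =
      G * ((u i - m) * (u j - m))
        - 2 * (B + G * m) / ((n : ℝ) - 2) * ((u i - m) + (u j - m))
        - (A + 2 * B * m + G * m ^ 2) / ((n : ℝ) - 1) := by
  have hn' : (4 : ℝ) ≤ n := by exact_mod_cast hn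
  have h2 : (n : ℝ) - 2 ≠ 0 := by linarith
  have h1 : (n : ℝ) - 1 ≠ 0 := by linarith
  have row : ∀ i, ∑ t, biaffineMatrix A B G u i t
      = n * (A + B * u i) + (B + G * u i) * (n * m) := by
    intro i
    simp only [biaffineMatrix, Matrix.of_apply]
    have : ∀ t, A + B * (u i + u t) + G * (u i * u t)
        = (A + B * u i) + (B + G * u i) * u t := fun t => by ring
    simp only [this, Finset.sum_add_distrib (f := fun _ => A + B * u i), Finset.sum_const,
      Finset.card_univ, Fintype.card_fin, nsmul_eq_mul, ← Finset.mul_sum, hm]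
  have col : ∀ j, ∑ s, biaffineMatrix A B G u s j
      = n * (A + B * u j) + (B + G * u j) * (n * m) := by
    intro j
    rw [← row j]
    refine Finset.sum_congr rfl fun s _ => ?_
    simp only [biaffineMatrix, Matrix.of_apply]
    ring
  have tot : ∑ s, ∑ t, biaffineMatrix A B G u s t
      = n * (n * A) + 2 * B * n * (n * m) + G * (n * m) * (n * m) := by
    simp only [row]
    have : ∀ s, n * (A + B * u s) + (B + G * u s) * (n * m)
        = (n * A + B * (n * m)) + (B * n + G * (n * m)) * u s := fun s => by ring
    simp only [this, Finset.sum_add_distrib (f := fun _ => n * A + B * (n * m)), Finset.sum_const,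
      Finset.card_univ, Fintype.card_fin, nsmul_eq_mul, ← Finset.mul_sum, hm]
    ring
  simp only [modifiedMatrix, Matrix.of_apply, if_neg hij]
  rw [row, col, tot]
  simp only [biaffineMatrix, Matrix.of_apply]
  field_simp
  ring

/-- The centered matrices vanish on the diagonal, so off-diagonal formulas `f`, `g` for their
entries, extended to the diagonal, determine the trace after removing the diagonal terms. -/
theorem trace_modifiedMatrix_mul {n : ℕ} (A B : Matrix (Fin n) (Fin n) ℝ)
    (hB : B.IsSymm) (f g : Fin n → Fin n → ℝ)
    (hf : ∀ i j, i ≠ j → modifiedMatrix A i j = f i j)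
    (hg : ∀ i j, i ≠ j → modifiedMatrix B i j = g i j) :
    (modifiedMatrix A * modifiedMatrix B).trace
      = ∑ i, ∑ j, f i j * g i j - ∑ i, f i i * g i i := by
  have hsymm : ∀ i j, modifiedMatrix B j i = modifiedMatrix B i j := by
    intro i j
    have hB' : ∀ i j, B i j = B j i := fun i j => hB.apply j i
    simp only [modifiedMatrix, Matrix.of_apply, eq_comm (a := j) (b := i)]
    split_ifs
    · rfl
    · rw [hB' j i, Finset.sum_congr rfl fun t _ => hB' j t,
        Finset.sum_congr rfl fun t _ => hB' t i]
      ring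
  simp only [Matrix.trace, Matrix.diag_apply, Matrix.mul_apply]
  rw [← Finset.sum_sub_distrib]
  refine Finset.sum_congr rfl fun i _ => ?_
  rw [← Finset.add_sum_erase _ (fun j => f i j * g i j) (Finset.mem_univ i), add_sub_cancel_left,
    ← Finset.add_sum_erase _ _ (Finset.mem_univ i)]
  have h0 : modifiedMatrix A i i = 0 := by simp [modifiedMatrix]
  rw [h0, zero_mul, zero_add]
  refine Finset.sum_congr rfl fun j hj => ?_
  have hij : i ≠ j := (Finset.ne_of_mem_erase hj).symm
  rw [hsymm, hf i j hij, hg i j hij]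

/-- The double sum factorises because all terms containing a lone sum of `v` or `w` vanish. -/
theorem sum_sum_centered_mul {n : ℕ} (v w : Fin n → ℝ) (hv : ∑ i, v i = 0) (hw : ∑ i, w i = 0)
    (G β α G' β' α' : ℝ) :
    ∑ i, ∑ j, (G * (v i * v j) - β * (v i + v j) - α) * (G' * (w i * w j) - β' * (w i + w j) - α')
      = G * G' * (∑ i, v i * w i) ^ 2 + 2 * n * (β * β') * (∑ i, v i * w i)
        + n ^ 2 * (α * α') := by
  set S := ∑ i, v i * w i with hS
  have inner : ∀ i, ∑ j, (G * (v i * v j) - β * (v i + v j) - α)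
      * (G' * (w i * w j) - β' * (w i + w j) - α')
      = (G * v i - β) * (G' * w i - β') * S + n * ((β * v i + α) * (β' * w i + α')) := by
    intro i
    have : ∀ j, (G * (v i * v j) - β * (v i + v j) - α) * (G' * (w i * w j) - β' * (w i + w j) - α')
      = (G * v i - β) * (G' * w i - β') * (v j * w j)
        - (G * v i - β) * (β' * w i + α') * v j - (β * v i + α) * (G' * w i - β') * w j
        + (β * v i + α) * (β' * w i + α') := fun j => by ring
    simp only [this, Finset.sum_add_distrib, Finset.sum_sub_distrib, ← Finset.mul_sum, hv, hw, ← hS,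
      Finset.sum_const, Finset.card_univ, Fintype.card_fin, nsmul_eq_mul]
    ring
  simp only [inner]
  have : ∀ i, (G * v i - β) * (G' * w i - β') * S + n * ((β * v i + α) * (β' * w i + α'))
      = (G * G' * S + n * (β * β')) * (v i * w i)
        + (n * (β * α') - G * β' * S) * v i + (n * (α * β') - β * G' * S) * w i
        + (β * β' * S + n * (α * α')) := fun i => by ring
  simp only [this, Finset.sum_add_distrib, ← Finset.mul_sum, hv, hw, ← hS,
      Finset.sum_const, Finset.card_univ, Fintype.card_fin, nsmul_eq_mul]
  ring

/-- A bound for all coefficients of a bi-affine matrix after recentering at a point of `[0, 1]`. -/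
def coeffBound (A B G : ℝ) : ℝ := |A| + 2 * |B| + |G|

theorem abs_recentered_le (A B G : ℝ) {m : ℝ} (h0 : 0 ≤ m) (h1 : m ≤ 1) :
    |B + G * m| ≤ coeffBound A B G ∧ |A + 2 * B * m + G * m ^ 2| ≤ coeffBound A B G ∧
      |G| ≤ coeffBound A B G := by
  have hA := abs_nonneg A
  have hB := abs_nonneg B
  have hG := abs_nonneg G
  have e1 : |G * m| ≤ |G| := by
    rw [abs_mul, abs_of_nonneg h0]; exact mul_le_of_le_one_right hG h1
  have e2 : |2 * B * m| ≤ 2 * |B| := by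
    rw [abs_mul, abs_of_nonneg h0, abs_mul, abs_two]
    exact mul_le_of_le_one_right (by positivity) h1
  have e3 : |G * m ^ 2| ≤ |G| := by
    rw [abs_mul, abs_of_nonneg (sq_nonneg m)]
    exact mul_le_of_le_one_right hG (pow_le_one₀ h0 h1)
  unfold coeffBound
  refine ⟨?_, ?_, by linarith⟩
  · linarith [abs_add_le B (G * m)]
  · linarith [abs_add_le (A + 2 * B * m) (G * m ^ 2), abs_add_le A (2 * B * m)]

theorem abs_diagonal_factor_le {b a c v : ℝ} (hb : |b| ≤ 4 * c) (ha : |a| ≤ 2 * c)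
    (hv : |v| ≤ 1) : |b * (v + v) + a| ≤ 10 * c := by
  have h1 : |b * (v + v)| ≤ 2 * (4 * c) := by
    rw [abs_mul, ← two_mul, abs_mul, abs_two]
    nlinarith [abs_nonneg b, abs_nonneg v]
  calc |b * (v + v) + a| ≤ |b * (v + v)| + |a| := abs_add_le _ _
    _ ≤ 2 * (4 * c) + 2 * c := add_le_add h1 ha
    _ = 10 * c := by ring

/-- On the diagonal, the coefficients `β`, `α` of order `1 / r` are perturbations of the product
term; summed over `r` diagonal entries they stay bounded. -/
theorem abs_diagonal_term_sub_le {G β α v M G' β' α' w M' r : ℝ} (hr : 1 ≤ r) (hG : |G| ≤ M)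
    (hG' : |G'| ≤ M') (hβ : |β| ≤ 4 * (M / r)) (hα : |α| ≤ 2 * (M / r)) (hv : |v| ≤ 1)
    (hβ' : |β'| ≤ 4 * (M' / r)) (hα' : |α'| ≤ 2 * (M' / r)) (hw : |w| ≤ 1) :
    |(G * (v * v) - β * (v + v) - α) * (G' * (w * w) - β' * (w + w) - α')
      - G * G' * (v ^ 2 * w ^ 2)| ≤ 120 * (M * M') / r := by
  have hM : 0 ≤ M := (abs_nonneg _).trans hG
  have hM' : 0 ≤ M' := (abs_nonneg _).trans hG'
  have hr0 : 0 < r := by linarith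
  have p1 := abs_diagonal_factor_le hβ hα hv
  have p2 := abs_diagonal_factor_le hβ' hα' hw
  have q1 : |G * v ^ 2| ≤ M := by
    rw [abs_mul, abs_pow]
    exact (mul_le_of_le_one_right (abs_nonneg _) (pow_le_one₀ (abs_nonneg _) hv)).trans hG
  have q2 : |G' * w ^ 2| ≤ M' := by
    rw [abs_mul, abs_pow]
    exact (mul_le_of_le_one_right (abs_nonneg _) (pow_le_one₀ (abs_nonneg _) hw)).trans hG'
  have e : (G * (v * v) - β * (v + v) - α) * (G' * (w * w) - β' * (w + w) - α')
      - G * G' * (v ^ 2 * w ^ 2)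
      = (β * (v + v) + α) * (β' * (w + w) + α') - (G * v ^ 2) * (β' * (w + w) + α')
        - (β * (v + v) + α) * (G' * w ^ 2) := by ring
  rw [e]
  generalize β * (v + v) + α = x at *
  generalize β' * (w + w) + α' = y at *
  generalize G * v ^ 2 = g at *
  generalize G' * w ^ 2 = h at *
  have hMr : M / r ≤ M := div_le_self hM hr
  calc |x * y - g * y - x * h| ≤ |x| * |y| + |g| * |y| + |x| * |h| := by
        rw [← abs_mul, ← abs_mul, ← abs_mul]
        have h1 := abs_sub (x * y - g * y) (x * h)
        have h2 := abs_sub (x * y) (g * y)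
        linarith
    _ ≤ 10 * M * (10 * (M' / r)) + M * (10 * (M' / r)) + 10 * (M / r) * M' := by
        have p1' : |x| ≤ 10 * M := p1.trans (by linarith)
        gcongr
    _ = 120 * (M * M') / r := by ring

/-- Up to a bounded error, the trace of the product of two centered matrices only sees the product
terms: `∑ v w` comes from all pairs of indices, `∑ v² w²` removes the diagonal. -/
theorem abs_trace_sub_le (A B G A' B' G' : ℝ) {n : ℕ} (hn : 4 ≤ n) (u z : Fin n → ℝ) {m l : ℝ}
    (hm : ∑ i, u i = n * m) (hl : ∑ i, z i = n * l)
    (hu : ∀ i, 0 ≤ u i ∧ u i ≤ 1) (hz : ∀ i, 0 ≤ z i ∧ z i ≤ 1)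
    (hm0 : 0 ≤ m) (hm1 : m ≤ 1) (hl0 : 0 ≤ l) (hl1 : l ≤ 1) :
    |(modifiedMatrix (biaffineMatrix A B G u) * modifiedMatrix (biaffineMatrix A' B' G' z)).trace
      - G * G' * ((∑ i, (u i - m) * (z i - l)) ^ 2 - ∑ i, (u i - m) ^ 2 * (z i - l) ^ 2)|
      ≤ 156 * (coeffBound A B G * coeffBound A' B' G') := by
  obtain ⟨hB, hA, hG⟩ := abs_recentered_le A B G hm0 hm1
  obtain ⟨hB', hA', hG'⟩ := abs_recentered_le A' B' G' hl0 hl1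
  set M := coeffBound A B G
  set M' := coeffBound A' B' G'
  have hM : 0 ≤ M := (abs_nonneg _).trans hG
  have hM' : 0 ≤ M' := (abs_nonneg _).trans hG'
  have hn' : (4 : ℝ) ≤ n := by exact_mod_cast hn
  have hn0 : (0 : ℝ) < n := by linarith
  have hβ : ∀ {b M : ℝ}, |b| ≤ M → |2 * b / ((n : ℝ) - 2)| ≤ 4 * (M / n) := by
    intro b M hb
    rw [abs_div, abs_mul, abs_two, abs_of_pos (by linarith : (0 : ℝ) < n - 2),
      ← mul_div_assoc, div_le_div_iff₀ (by linarith) hn0]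
    nlinarith [abs_nonneg b]
  have hα : ∀ {a M : ℝ}, |a| ≤ M → |a / ((n : ℝ) - 1)| ≤ 2 * (M / n) := by
    intro b M hb
    rw [abs_div, abs_of_pos (by linarith : (0 : ℝ) < n - 1),
      ← mul_div_assoc, div_le_div_iff₀ (by linarith) hn0]
    nlinarith [abs_nonneg b]
  have hsymm : (biaffineMatrix A' B' G' z).IsSymm := by
    ext i j
    simp only [Matrix.transpose_apply, biaffineMatrix, Matrix.of_apply]
    ring
  rw [trace_modifiedMatrix_mul _ _ hsymm _ _
    (fun i j h => modifiedMatrix_biaffineMatrix A B G hn u hm h)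
    (fun i j h => modifiedMatrix_biaffineMatrix A' B' G' hn z hl h)]
  have hv0 : ∑ i, (u i - m) = 0 := by simp [Finset.sum_sub_distrib, hm]
  have hw0 : ∑ i, (z i - l) = 0 := by simp [Finset.sum_sub_distrib, hl]
  rw [sum_sum_centered_mul (fun i => u i - m) (fun i => z i - l) hv0 hw0]
  have hb := hβ hB
  have hb' := hβ hB'
  have ha := hα hA
  have ha' := hα hA'
  generalize 2 * (B + G * m) / ((n : ℝ) - 2) = β at *
  generalize 2 * (B' + G' * l) / ((n : ℝ) - 2) = β' at *
  generalize (A + 2 * B * m + G * m ^ 2) / ((n : ℝ) - 1) = α at *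
  generalize (A' + 2 * B' * l + G' * l ^ 2) / ((n : ℝ) - 1) = α' at *
  have hv : ∀ i, |u i - m| ≤ 1 := fun i => abs_le.2 ⟨by linarith [hu i], by linarith [hu i]⟩
  have hw : ∀ i, |z i - l| ≤ 1 := fun i => abs_le.2 ⟨by linarith [hz i], by linarith [hz i]⟩
  have hS : |∑ i, (u i - m) * (z i - l)| ≤ n := by
    refine (Finset.abs_sum_le_sum_abs _ _).trans ?_
    calc ∑ i, |(u i - m) * (z i - l)| ≤ ∑ i : Fin n, (1 : ℝ) := by
          refine Finset.sum_le_sum fun i _ => ?_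
          rw [abs_mul]
          exact mul_le_one₀ (hv i) (abs_nonneg _) (hw i)
      _ = n := by simp
  -- The constant `156` is the sum of the bounds `32` and `4` for the two lower order terms of the
  -- full double sum and `120` for those of the diagonal.
  have t1 : |2 * n * (β * β') * ∑ i, (u i - m) * (z i - l)| ≤ 32 * (M * M') := by
    rw [abs_mul, abs_mul, abs_mul β, abs_of_pos (by positivity : (0 : ℝ) < 2 * n)]
    calc 2 * n * (|β| * |β'|) * |∑ i, (u i - m) * (z i - l)|
        ≤ 2 * n * (4 * (M / n) * (4 * (M' / n))) * n := by gcongr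
      _ = 32 * (M * M') := by field_simp; ring
  have t2 : |n ^ 2 * (α * α')| ≤ 4 * (M * M') := by
    rw [abs_mul, abs_mul, abs_of_pos (by positivity : (0 : ℝ) < (n : ℝ) ^ 2)]
    calc (n : ℝ) ^ 2 * (|α| * |α'|) ≤ n ^ 2 * (2 * (M / n) * (2 * (M' / n))) := by gcongr
      _ = 4 * (M * M') := by field_simp; ring
  have t3 : |∑ i, ((G * ((u i - m) * (u i - m)) - β * ((u i - m) + (u i - m)) - α)
        * (G' * ((z i - l) * (z i - l)) - β' * ((z i - l) + (z i - l)) - α')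
        - G * G' * ((u i - m) ^ 2 * (z i - l) ^ 2))| ≤ 120 * (M * M') := by
    refine (Finset.abs_sum_le_sum_abs _ _).trans ?_
    calc _ ≤ ∑ i : Fin n, 120 * (M * M') / n :=
          Finset.sum_le_sum fun i _ => abs_diagonal_term_sub_le (by linarith) hG hG' hb ha (hv i)
            hb' ha' (hw i)
      _ = 120 * (M * M') := by
          rw [Finset.sum_const, Finset.card_univ, Fintype.card_fin, nsmul_eq_mul,
            mul_div_cancel₀ _ hn0.ne']
  rw [Finset.sum_sub_distrib, ← Finset.mul_sum] at t3
  have hMM : 0 ≤ M * M' := by positivity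
  rw [abs_le] at t1 t2 t3 ⊢
  constructor <;> linarith

/-! ### The sign of the interaction coefficient -/

theorem IsStrongNegativeTypeMetric.interaction_neg {E : Type*} [MeasurableSpace E]
    {d : E → E → ℝ} (hd : IsStrongNegativeTypeMetric d) {a b : E} (hab : a ≠ b) :
    d a a + d b b - 2 * d a b < 0 := by
  have h0 : 0 ≤ d a b := by
    have := hd.triangle a b a
    rw [hd.self, hd.symm b a] at this
    linarith
  have h1 : d a b ≠ 0 := fun h => hab (hd.eq_of_eq_zero a b h)
  have h2 : 0 < d a b := lt_of_le_of_ne h0 h1.symm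
  rw [hd.self, hd.self]
  linarith

/-- If the squared kernel distance of `a` and `b` vanished, the Cauchy–Schwarz inequality would
identify the mean embeddings of the Dirac masses at `a` and `b`. -/
theorem IsCharacteristicKernel.interaction_pos {E : Type*} [MeasurableSpace E]
    [MeasurableSingletonClass E] {k : E → E → ℝ} (hk : IsCharacteristicKernel k) {a b : E}
    (hab : a ≠ b) : 0 < k a a + k b b - 2 * k a b := by
  classical
  -- The quadratic form at the weights `t δ_x + δ_a - δ_b`.
  have quad : ∀ x t, 0 ≤ k x x * (t * t) + 2 * (k x a - k x b) * t
      + (k a a + k b b - 2 * k a b) := by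
    intro x t
    have h := hk.posSemidef {x, a, b}
      (fun y => (if y = x then t else 0) + (if y = a then 1 else 0) - (if y = b then 1 else 0))
    have lin : ∀ f : E → ℝ, ∑ y ∈ ({x, a, b} : Finset E), ((if y = x then t else 0)
        + (if y = a then 1 else 0) - (if y = b then 1 else 0)) * f y
        = t * f x + f a - f b := by
      intro f
      simp only [sub_mul, add_mul, ite_mul, zero_mul, one_mul, Finset.sum_sub_distrib,
        Finset.sum_add_distrib, Finset.sum_ite_eq', Finset.mem_insert, Finset.mem_singleton,
        true_or, or_true, if_true]
    simp only [mul_assoc, ← Finset.mul_sum, lin] at h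
    rw [hk.symm a x, hk.symm b x, hk.symm b a] at h
    linarith
  have hnonneg : 0 ≤ k a a + k b b - 2 * k a b := by simpa using quad a 0
  refine lt_of_le_of_ne hnonneg fun h0 => hab ?_
  have heq : ∀ x, k x a = k x b := by
    intro x
    have := discrim_le_zero (quad x)
    rw [discrim, ← h0] at this
    have h2 : (k x a - k x b) ^ 2 = 0 := le_antisymm (by linarith) (sq_nonneg _)
    exact sub_eq_zero.1 (pow_eq_zero_iff two_ne_zero |>.1 h2)
  have hint : ∀ c, Integrable (fun x => Real.sqrt (k x x)) (Measure.dirac c) := fun c =>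
    integrable_dirac (by simp)
  have hdirac := hk.embedding_injective (Measure.dirac a) (Measure.dirac b) (hint a) (hint b)
    (fun x => by rw [integral_dirac, integral_dirac, heq x])
  exact dirac_eq_dirac_iff.1 hdirac

/-! ### Almost sure limits of the sample statistics -/

/-- The mean of the first `n` terms of a sequence. -/
noncomputable def avg (u : ℕ → ℝ) (n : ℕ) : ℝ := (∑ i ∈ Finset.range n, u i) / n

/-- The centered cross moment `∑ (u i - ū) (z i - z̄)` of the first `n` terms. -/
noncomputable def crossSum (u z : ℕ → ℝ) (n : ℕ) : ℝ :=
  ∑ i ∈ Finset.range n, (u i - avg u n) * (z i - avg z n)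

/-- The squared centered cross moment `∑ (u i - ū)² (z i - z̄)²` of the first `n` terms. -/
noncomputable def crossSqSum (u z : ℕ → ℝ) (n : ℕ) : ℝ :=
  ∑ i ∈ Finset.range n, (u i - avg u n) ^ 2 * (z i - avg z n) ^ 2

theorem sum_eq_mul_avg (u : ℕ → ℝ) (n : ℕ) : ∑ i ∈ Finset.range n, u i = n * avg u n := by
  rcases eq_or_ne n 0 with rfl | hn
  · simp
  · have : (n : ℝ) ≠ 0 := by exact_mod_cast hn
    rw [avg, mul_div_cancel₀ _ this]

theorem avg_mem_Icc {u : ℕ → ℝ} (hu : ∀ i, u i = 0 ∨ u i = 1) (n : ℕ) :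
    0 ≤ avg u n ∧ avg u n ≤ 1 := by
  have h : ∀ i, 0 ≤ u i ∧ u i ≤ 1 := fun i => by rcases hu i with h | h <;> simp [h]
  refine ⟨div_nonneg (Finset.sum_nonneg fun i _ => (h i).1) (Nat.cast_nonneg n), ?_⟩
  refine div_le_one_of_le₀ ?_ (Nat.cast_nonneg n)
  calc ∑ i ∈ Finset.range n, u i ≤ ∑ i ∈ Finset.range n, (1 : ℝ) :=
        Finset.sum_le_sum fun i _ => (h i).2
    _ = n := by simp

/-- For indicators, the squares of the centered variables are affine in them, so that the moment
is a polynomial in the three empirical means. -/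
theorem crossSqSum_eq {u z : ℕ → ℝ} (hu : ∀ i, u i = 0 ∨ u i = 1) (hz : ∀ i, z i = 0 ∨ z i = 1)
    (n : ℕ) :
    crossSqSum u z n = n * (avg (fun i => u i * z i) n * (1 - 2 * avg u n) * (1 - 2 * avg z n)
      + avg u n * (1 - 2 * avg u n) * avg z n ^ 2 + avg u n ^ 2 * (avg z n * (1 - 2 * avg z n))
      + avg u n ^ 2 * avg z n ^ 2) := by
  have hsq : ∀ {u : ℕ → ℝ}, (∀ i, u i = 0 ∨ u i = 1) → ∀ i (m : ℝ),
      (u i - m) ^ 2 = u i * (1 - 2 * m) + m ^ 2 := by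
    intro u hu i m
    rcases hu i with h | h <;> rw [h] <;> ring
  have key : ∀ i, (u i - avg u n) ^ 2 * (z i - avg z n) ^ 2
      = (u i * z i) * ((1 - 2 * avg u n) * (1 - 2 * avg z n))
        + u i * ((1 - 2 * avg u n) * avg z n ^ 2) + z i * ((1 - 2 * avg z n) * avg u n ^ 2)
        + avg u n ^ 2 * avg z n ^ 2 := by
    intro i
    rw [hsq hu, hsq hz]
    ring
  simp only [crossSqSum, key, Finset.sum_add_distrib, ← Finset.sum_mul, Finset.sum_const,
    Finset.card_range, nsmul_eq_mul]
  rw [sum_eq_mul_avg u, sum_eq_mul_avg z, sum_eq_mul_avg (fun i => u i * z i)]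
  ring

theorem tendsto_crossSqSum_div {u z : ℕ → ℝ} (hu : ∀ i, u i = 0 ∨ u i = 1)
    (hz : ∀ i, z i = 0 ∨ z i = 1) {p q : ℝ} (hp : Tendsto (avg u) atTop (𝓝 p))
    (hq : Tendsto (avg z) atTop (𝓝 q))
    (hpq : Tendsto (avg fun i => u i * z i) atTop (𝓝 (p * q))) :
    Tendsto (fun n : ℕ => crossSqSum u z n / n) atTop (𝓝 (p * (1 - p) * (q * (1 - q)))) := by
  have h : Tendsto (fun n : ℕ => avg (fun i => u i * z i) n * (1 - 2 * avg u n) * (1 - 2 * avg z n)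
      + avg u n * (1 - 2 * avg u n) * avg z n ^ 2 + avg u n ^ 2 * (avg z n * (1 - 2 * avg z n))
      + avg u n ^ 2 * avg z n ^ 2) atTop
      (𝓝 (p * q * (1 - 2 * p) * (1 - 2 * q) + p * (1 - 2 * p) * q ^ 2
        + p ^ 2 * (q * (1 - 2 * q)) + p ^ 2 * q ^ 2)) := by
    have hu' := tendsto_const_nhds (x := (1 : ℝ)) |>.sub (hp.const_mul 2)
    have hz' := tendsto_const_nhds (x := (1 : ℝ)) |>.sub (hq.const_mul 2)
    exact ((((hpq.mul hu').mul hz').add ((hp.mul hu').mul (hq.pow 2))).add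
      ((hp.pow 2).mul (hq.mul hz'))).add ((hp.pow 2).mul (hq.pow 2))
  have e : p * (1 - p) * (q * (1 - q)) = p * q * (1 - 2 * p) * (1 - 2 * q)
      + p * (1 - 2 * p) * q ^ 2 + p ^ 2 * (q * (1 - 2 * q)) + p ^ 2 * q ^ 2 := by ring
  rw [e]
  refine h.congr' ?_
  filter_upwards [eventually_gt_atTop 0] with n hn
  have : (n : ℝ) ≠ 0 := by positivity
  rw [crossSqSum_eq hu hz, mul_div_cancel_left₀ _ this]

theorem tendsto_crossSum_self_div {u : ℕ → ℝ} (hu : ∀ i, u i = 0 ∨ u i = 1) {p : ℝ}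
    (hp : Tendsto (avg u) atTop (𝓝 p)) :
    Tendsto (fun n : ℕ => crossSum u u n / n) atTop (𝓝 (p * (1 - p))) := by
  refine (hp.mul (tendsto_const_nhds.sub hp)).congr' ?_
  filter_upwards [eventually_gt_atTop 0] with n hn
  have hn' : (n : ℝ) ≠ 0 := by positivity
  have key : ∀ i, (u i - avg u n) * (u i - avg u n) = u i * (1 - 2 * avg u n) + avg u n ^ 2 := by
    intro i
    rcases hu i with h | h <;> rw [h] <;> ring
  simp only [crossSum, key, Finset.sum_add_distrib, ← Finset.sum_mul, Finset.sum_const,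
    Finset.card_range, nsmul_eq_mul]
  rw [sum_eq_mul_avg u]
  field_simp
  ring

/-- The sample distance covariance of two bi-affine matrices, up to an error of order `n⁻²`. -/
theorem abs_dcov_biaffineMatrix_sub_le (A B G A' B' G' : ℝ) {n : ℕ} (hn : 4 ≤ n) {u z : ℕ → ℝ}
    (hu : ∀ i, u i = 0 ∨ u i = 1) (hz : ∀ i, z i = 0 ∨ z i = 1) :
    |(n : ℝ) * (n - 3) * dcov (biaffineMatrix A B G fun i : Fin n => u i)
        (biaffineMatrix A' B' G' fun i : Fin n => z i)
      - G * G' * (crossSum u z n ^ 2 - crossSqSum u z n)|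
      ≤ 156 * (coeffBound A B G * coeffBound A' B' G') := by
  have hn' : (4 : ℝ) ≤ n := by exact_mod_cast hn
  have e : (n : ℝ) * (n - 3) ≠ 0 := mul_ne_zero (by linarith) (by linarith)
  have h01 : ∀ {u : ℕ → ℝ}, (∀ i, u i = 0 ∨ u i = 1) → ∀ i, 0 ≤ u i ∧ u i ≤ 1 :=
    fun hu i => by rcases hu i with h | h <;> simp [h]
  obtain ⟨a0, a1⟩ := avg_mem_Icc hu n
  obtain ⟨b0, b1⟩ := avg_mem_Icc hz n
  have hsum : ∀ f : ℕ → ℝ, ∑ i : Fin n, f i = ∑ i ∈ Finset.range n, f i :=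
    fun f => Fin.sum_univ_eq_sum_range f n
  have := abs_trace_sub_le A B G A' B' G' hn (fun i : Fin n => u i) (fun i : Fin n => z i)
    ((hsum u).trans (sum_eq_mul_avg u n)) ((hsum z).trans (sum_eq_mul_avg z n))
    (fun i => h01 hu i) (fun i => h01 hz i) a0 a1 b0 b1
  rw [hsum fun i => (u i - avg u n) * (z i - avg z n),
    hsum fun i => (u i - avg u n) ^ 2 * (z i - avg z n) ^ 2] at this
  rw [dcov, ← mul_assoc, mul_one_div_cancel e, one_mul]
  exact this

theorem tendsto_bounded_div_atTop {f : ℕ → ℝ} {K : ℝ} (hf : ∀ᶠ n in atTop, |f n| ≤ K) :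
    Tendsto (fun n : ℕ => f n / n) atTop (𝓝 0) := by
  refine squeeze_zero_norm' ?_ (tendsto_const_div_atTop_nhds_zero_nat K)
  filter_upwards [hf] with n hn
  rw [norm_div, Real.norm_eq_abs, Real.norm_natCast]
  gcongr

theorem tendsto_natCast_div_sub_three :
    Tendsto (fun n : ℕ => (n : ℝ) / (n - 3)) atTop (𝓝 1) := by
  have h : Tendsto (fun n : ℕ => (1 : ℝ) / (1 - 3 / n)) atTop (𝓝 (1 / (1 - 0))) :=
    tendsto_const_nhds.div (tendsto_const_nhds.sub (tendsto_const_div_atTop_nhds_zero_nat 3))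
      (by norm_num)
  rw [sub_zero, div_one] at h
  refine h.congr' ?_
  filter_upwards [eventually_ge_atTop 4] with n hn
  have hn' : (4 : ℝ) ≤ n := by exact_mod_cast hn
  have : (n : ℝ) - 3 ≠ 0 := by linarith
  have : (n : ℝ) ≠ 0 := by linarith
  field_simp

/-- The diagonal correction is of order `n` and the squared cross moment of order `n²`, so only the
latter contributes to the limit. -/
theorem tendsto_dcov_self (A B G : ℝ) {u : ℕ → ℝ} (hu : ∀ i, u i = 0 ∨ u i = 1) {p : ℝ}
    (hp : Tendsto (avg u) atTop (𝓝 p)) :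
    Tendsto (fun n : ℕ => dcov (biaffineMatrix A B G fun i : Fin n => u i)
      (biaffineMatrix A B G fun i : Fin n => u i)) atTop (𝓝 ((G * (p * (1 - p))) ^ 2)) := by
  set D : ℕ → ℝ := fun n => dcov (biaffineMatrix A B G fun i : Fin n => u i)
      (biaffineMatrix A B G fun i : Fin n => u i)
  set err : ℕ → ℝ := fun n => (n : ℝ) * (n - 3) * D n
    - G * G * (crossSum u u n ^ 2 - crossSqSum u u n)
  have herr : Tendsto (fun n : ℕ => err n / n / n) atTop (𝓝 0) := by
    have := (tendsto_bounded_div_atTop (f := err) <| by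
      filter_upwards [eventually_ge_atTop 4] with n hn
      exact abs_dcov_biaffineMatrix_sub_le A B G A B G hn hu hu).mul
      (tendsto_const_div_atTop_nhds_zero_nat (1 : ℝ))
    rw [zero_mul] at this
    refine this.congr fun n => ?_
    rw [mul_one_div]
  have hQ : Tendsto (fun n : ℕ => crossSqSum u u n / n / n) atTop (𝓝 0) := by
    have huu : ∀ i, u i * u i = u i := fun i => by rcases hu i with h | h <;> simp [h]
    have h1 : Tendsto (fun n : ℕ => crossSqSum u u n / n) atTop
        (𝓝 (p * (1 - 2 * p) * (1 - 2 * p) + p * (1 - 2 * p) * p ^ 2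
        + p ^ 2 * (p * (1 - 2 * p)) + p ^ 2 * p ^ 2)) := by
      have hu' := tendsto_const_nhds (x := (1 : ℝ)) |>.sub (hp.const_mul 2)
      refine (((((hp.mul hu').mul hu').add ((hp.mul hu').mul (hp.pow 2))).add
        ((hp.pow 2).mul (hp.mul hu'))).add ((hp.pow 2).mul (hp.pow 2))).congr' ?_
      filter_upwards [eventually_gt_atTop 0] with n hn
      have : (n : ℝ) ≠ 0 := by positivity
      rw [crossSqSum_eq hu hu, mul_div_cancel_left₀ _ this]
      simp only [huu]
    have := h1.mul (tendsto_const_div_atTop_nhds_zero_nat (1 : ℝ))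
    rw [mul_zero] at this
    refine this.congr fun n => ?_
    rw [mul_one_div]
  have hS := (tendsto_crossSum_self_div hu hp).pow 2
  have := (((hS.sub hQ).const_mul (G * G)).add herr).mul tendsto_natCast_div_sub_three
  have e : (G * G * ((p * (1 - p)) ^ 2 - 0) + 0) * 1 = (G * (p * (1 - p))) ^ 2 := by ring
  rw [e] at this
  refine this.congr' ?_
  filter_upwards [eventually_ge_atTop 4] with n hn
  have hn' : (4 : ℝ) ≤ n := by exact_mod_cast hn
  have h3 : (n : ℝ) - 3 ≠ 0 := by linarith
  have h0 : (n : ℝ) ≠ 0 := by linarith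
  simp only [err]
  field_simp
  ring

/-- The `0 / 0` convention makes the positivity test in the definition of `dcor` redundant. -/
theorem dcor_eq {E F : Type*} (dX : E → E → ℝ) (dY : F → F → ℝ) {n : ℕ} (hn : 4 ≤ n)
    (x : Fin n → E) (y : Fin n → F) :
    dcor dX dY x y = dcov (distMatrix dX x) (distMatrix dY y)
      / Real.sqrt (dcov (distMatrix dX x) (distMatrix dX x)
        * dcov (distMatrix dY y) (distMatrix dY y)) := by
  unfold dcor
  split_ifs with h
  · rfl
  · have : Real.sqrt (dcov (distMatrix dX x) (distMatrix dX x)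
        * dcov (distMatrix dY y) (distMatrix dY y)) = 0 :=
      le_antisymm (not_lt.1 fun h' => h ⟨hn, h'⟩) (Real.sqrt_nonneg _)
    rw [this, div_zero]

/-- Along a typical pair of samples, `n` times the distance correlation is an affine function of the
square of the normalised cross moment, with slope tending to `1` and intercept tending to `-1`. -/
theorem tendsto_dcor_decomposition {A B G A' B' G' : ℝ} (hGG : 0 < G * G') {u z : ℕ → ℝ}
    (hu : ∀ i, u i = 0 ∨ u i = 1) (hz : ∀ i, z i = 0 ∨ z i = 1) {p q : ℝ}
    (hp0 : 0 < p) (hp1 : p < 1) (hq0 : 0 < q) (hq1 : q < 1)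
    (hp : Tendsto (avg u) atTop (𝓝 p)) (hq : Tendsto (avg z) atTop (𝓝 q))
    (hpq : Tendsto (avg fun i => u i * z i) atTop (𝓝 (p * q)))
    {DX DY DXY : ℕ → ℝ}
    (hDX : ∀ n, DX n = dcov (biaffineMatrix A B G fun i : Fin n => u i)
      (biaffineMatrix A B G fun i : Fin n => u i))
    (hDY : ∀ n, DY n = dcov (biaffineMatrix A' B' G' fun i : Fin n => z i)
      (biaffineMatrix A' B' G' fun i : Fin n => z i))
    (hDXY : ∀ n, DXY n = dcov (biaffineMatrix A B G fun i : Fin n => u i)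
      (biaffineMatrix A' B' G' fun i : Fin n => z i)) :
    Tendsto (fun n : ℕ => (n : ℝ) / (n - 3) * (G * G' * (p * (1 - p) * (q * (1 - q))))
        / Real.sqrt (DX n * DY n)) atTop (𝓝 1) ∧
    Tendsto (fun n : ℕ => n * (DXY n / Real.sqrt (DX n * DY n))
        - ((Real.sqrt n)⁻¹ * crossSum u z n / Real.sqrt (p * (1 - p) * (q * (1 - q)))) ^ 2
          * ((n : ℝ) / (n - 3) * (G * G' * (p * (1 - p) * (q * (1 - q))))
        / Real.sqrt (DX n * DY n))) atTop (𝓝 (-1)) := by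
  set s2 := p * (1 - p) * (q * (1 - q)) with hs2
  have hs : 0 < s2 := by
    have : 0 < 1 - p := by linarith
    have : 0 < 1 - q := by linarith
    positivity
  have hL : 0 < G * G' * s2 := mul_pos hGG hs
  have hroot : Tendsto (fun n => Real.sqrt (DX n * DY n)) atTop (𝓝 (G * G' * s2)) := by
    have := ((tendsto_dcov_self A B G hu hp).mul (tendsto_dcov_self A' B' G' hz hq)).sqrt
    have e : (G * (p * (1 - p))) ^ 2 * (G' * (q * (1 - q))) ^ 2 = (G * G' * s2) ^ 2 := by
      rw [hs2]; ring
    rw [e, Real.sqrt_sq hL.le] at this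
    refine this.congr fun n => ?_
    rw [hDX, hDY]
  have h1 : Tendsto (fun n : ℕ => (n : ℝ) / (n - 3) * (G * G' * s2)
        / Real.sqrt (DX n * DY n)) atTop (𝓝 1) := by
    have := (tendsto_natCast_div_sub_three.mul_const (G * G' * s2)).div hroot hL.ne'
    rwa [one_mul, div_self hL.ne'] at this
  refine ⟨h1, ?_⟩
  set err : ℕ → ℝ := fun n => (n : ℝ) * (n - 3) * DXY n
    - G * G' * (crossSum u z n ^ 2 - crossSqSum u z n)
  have herr : Tendsto (fun n : ℕ => err n / n) atTop (𝓝 0) := by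
    refine tendsto_bounded_div_atTop (K := 156 * (coeffBound A B G * coeffBound A' B' G')) ?_
    filter_upwards [eventually_ge_atTop 4] with n hn
    simp only [err, hDXY]
    exact abs_dcov_biaffineMatrix_sub_le A B G A' B' G' hn hu hz
  have hQ := tendsto_crossSqSum_div hu hz hp hq hpq
  have := ((herr.sub (hQ.const_mul (G * G'))).mul tendsto_natCast_div_sub_three).div hroot hL.ne'
  have e : (0 - G * G' * s2) * 1 / (G * G' * s2) = -1 := by
    rw [zero_sub, mul_one, neg_div, div_self hL.ne']
  rw [← hs2, e] at this
  refine this.congr' ?_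
  filter_upwards [eventually_ge_atTop 4, hroot.eventually (lt_mem_nhds hL)] with n hn hpos
  have hn' : (4 : ℝ) ≤ n := by exact_mod_cast hn
  have h3 : (n : ℝ) - 3 ≠ 0 := by linarith
  have h0 : (n : ℝ) ≠ 0 := by linarith
  have hsn : Real.sqrt n ^ 2 = n := Real.sq_sqrt (by linarith)
  have hss : Real.sqrt s2 ^ 2 = s2 := Real.sq_sqrt hs.le
  rw [div_pow, mul_pow, inv_pow, hsn, hss]
  have hpos' := hpos.ne'
  simp only [Pi.div_apply, err]
  field_simp
  ring

/-! ### Central limit theorem for the cross moment -/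

/-- If `f n` and `g n` are of order `n ^ (-1/2)` in quadratic mean, then their product is
negligible at the scale `n ^ (-1/2)`. -/
theorem tendstoInMeasure_sqrt_mul_mul {Ω : Type*} [MeasurableSpace Ω] {P : Measure Ω}
    [IsProbabilityMeasure P] {f g : ℕ → Ω → ℝ} (hf : ∀ n, MemLp (f n) 2 P)
    (hg : ∀ n, MemLp (g n) 2 P) {C D : ℝ} (hfC : ∀ n, 0 < n → ∫ ω, f n ω ^ 2 ∂P ≤ C / n)
    (hgD : ∀ n, 0 < n → ∫ ω, g n ω ^ 2 ∂P ≤ D / n) :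
    TendstoInMeasure P (fun (n : ℕ) ω => Real.sqrt n * (f n ω * g n ω)) atTop (fun _ => 0) := by
  rw [tendstoInMeasure_iff_measureReal_norm]
  intro ε hε
  have hlim : Tendsto (fun n : ℕ => ε⁻¹ * ((C + D) / 2 * (Real.sqrt n)⁻¹)) atTop (𝓝 0) := by
    have h := ((tendsto_inv_atTop_zero.comp (Real.tendsto_sqrt_atTop.comp
      tendsto_natCast_atTop_atTop)).const_mul ((C + D) / 2)).const_mul ε⁻¹
    simpa using h
  refine squeeze_zero' (Eventually.of_forall fun n => measureReal_nonneg) ?_ hlim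
  filter_upwards [eventually_gt_atTop 0] with n hn
  have hn' : (0 : ℝ) < n := by exact_mod_cast hn
  have hs : 0 < Real.sqrt n := Real.sqrt_pos.2 hn'
  have hsn : Real.sqrt n * Real.sqrt n = n := Real.mul_self_sqrt hn'.le
  set h : Ω → ℝ := fun ω => Real.sqrt n / 2 * (f n ω ^ 2 + g n ω ^ 2) with hh
  have hint : Integrable h P := ((hf n).integrable_sq.add (hg n).integrable_sq).const_mul _
  have hle : ∫ ω, h ω ∂P ≤ (C + D) / 2 * (Real.sqrt n)⁻¹ := by
    rw [hh, integral_const_mul, integral_add (hf n).integrable_sq (hg n).integrable_sq]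
    calc Real.sqrt n / 2 * (∫ ω, f n ω ^ 2 ∂P + ∫ ω, g n ω ^ 2 ∂P)
        ≤ Real.sqrt n / 2 * (C / n + D / n) := by
          gcongr
          · exact hfC n hn
          · exact hgD n hn
      _ = (C + D) / 2 * (Real.sqrt n)⁻¹ := by
          nth_rewrite 2 3 [← hsn]
          field_simp
  have hmarkov := mul_meas_ge_le_integral_of_nonneg (μ := P) (f := h)
    (Eventually.of_forall fun ω => by simp only [hh, Pi.zero_apply]; positivity) hint ε
  have hsub : P.real {ω | ε ≤ ‖Real.sqrt n * (f n ω * g n ω) - 0‖} ≤ P.real {ω | ε ≤ h ω} := by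
    refine measureReal_mono fun ω hω => ?_
    simp only [Set.mem_ofPred_eq, sub_zero, Real.norm_eq_abs, abs_mul, abs_of_pos hs] at hω ⊢
    refine hω.trans ?_
    simp only [hh]
    have := two_mul_le_add_sq |f n ω| |g n ω|
    rw [sq_abs, sq_abs] at this
    nlinarith
  calc _ ≤ P.real {ω | ε ≤ h ω} := hsub
    _ ≤ ε⁻¹ * ∫ ω, h ω ∂P := by
        rw [inv_mul_eq_div, le_div_iff₀ hε, mul_comm]; exact hmarkov
    _ ≤ _ := by gcongr

section Indicators

variable {Ω : Type*} [MeasurableSpace Ω] {P : Measure Ω}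

theorem memLp_of_zero_or_one [IsProbabilityMeasure P] {u : Ω → ℝ} (hm : AEMeasurable u P)
    (h : ∀ ω, u ω = 0 ∨ u ω = 1) :
    MemLp u 2 P := by
  refine MemLp.of_bound hm.aestronglyMeasurable 1 (Eventually.of_forall fun ω => ?_)
  rcases h ω with h | h <;> simp [h]

theorem integral_sub_mean_sq [IsProbabilityMeasure P] {u : Ω → ℝ} (hm : AEMeasurable u P)
    (h : ∀ ω, u ω = 0 ∨ u ω = 1) :
    ∫ ω, (u ω - P[u]) ^ 2 ∂P = P[u] * (1 - P[u]) := by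
  have hint : Integrable u P := (memLp_of_zero_or_one hm h).integrable (by norm_num)
  have e : ∀ ω, (u ω - P[u]) ^ 2 = u ω * (1 - 2 * P[u]) + P[u] ^ 2 := by
    intro ω
    rcases h ω with h | h <;> rw [h] <;> ring
  simp only [e]
  rw [integral_add (hint.mul_const _) (integrable_const _), integral_mul_const, integral_const]
  simp
  ring

theorem aemeasurable_avg {u : ℕ → Ω → ℝ} (hm : ∀ i, AEMeasurable (u i) P) (n : ℕ) :
    AEMeasurable (fun ω => avg (fun i => u i ω) n) P :=
  (Finset.aemeasurable_fun_sum _ fun i _ => hm i).div_const _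

theorem memLp_avg_sub [IsProbabilityMeasure P] {u : ℕ → Ω → ℝ} (hm : ∀ i, AEMeasurable (u i) P)
    (h : ∀ i ω, u i ω = 0 ∨ u i ω = 1) (p : ℝ) (n : ℕ) :
    MemLp (fun ω => avg (fun i => u i ω) n - p) 2 P := by
  refine MemLp.sub (MemLp.of_bound (aemeasurable_avg hm n).aestronglyMeasurable 1
    (Eventually.of_forall fun ω => ?_)) (memLp_const p)
  obtain ⟨h0, h1⟩ := avg_mem_Icc (fun i => h i ω) n
  rw [Real.norm_eq_abs, abs_of_nonneg h0]
  exact h1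

theorem integral_avg_sub_sq_le [IsProbabilityMeasure P] {u : ℕ → Ω → ℝ} (hindep : iIndepFun u P)
    (hident : ∀ i, IdentDistrib (u i) (u 0) P P) (h : ∀ i ω, u i ω = 0 ∨ u i ω = 1)
    {n : ℕ} (hn : 0 < n) :
    ∫ ω, (avg (fun i => u i ω) n - P[u 0]) ^ 2 ∂P ≤ Var[u 0; P] / n := by
  have hm : ∀ i, AEMeasurable (u i) P := fun i => (hident i).aemeasurable_fst
  have hn' : (n : ℝ) ≠ 0 := by positivity
  have hLp : ∀ i, MemLp (u i) 2 P := fun i => memLp_of_zero_or_one (hm i) (h i)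
  have hmean : ∫ ω, avg (fun i => u i ω) n ∂P = P[u 0] := by
    simp only [avg]
    rw [integral_div, integral_finsetSum _ fun i _ => (hLp i).integrable (by norm_num),
      Finset.sum_congr rfl fun i _ => (hident i).integral_eq]
    simp [hn']
  have hvar := IndepFun.variance_sum (s := Finset.range n) (fun i _ => hLp i)
    (fun i _ j _ hij => hindep.indepFun hij)
  rw [← hmean, ← variance_eq_integral (aemeasurable_avg hm n)]
  have e : (fun ω => avg (fun i => u i ω) n)
      = fun ω => (n : ℝ)⁻¹ * (∑ i ∈ Finset.range n, u i) ω := by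
    ext ω
    simp only [avg, Finset.sum_apply]
    rw [div_eq_inv_mul]
  rw [e, variance_const_mul, hvar, Finset.sum_congr rfl fun i _ => (hident i).variance_eq]
  simp only [Finset.sum_const, Finset.card_range, nsmul_eq_mul]
  apply le_of_eq
  field_simp

theorem ae_tendsto_avg {X : ℕ → Ω → ℝ} (hindep : iIndepFun X P)
    (hident : ∀ i, IdentDistrib (X i) (X 0) P P) (hint : Integrable (X 0) P) :
    ∀ᵐ ω ∂P, Tendsto (avg fun i => X i ω) atTop (𝓝 P[X 0]) :=
  strong_law_ae_real X hint (fun _ _ hij => hindep.indepFun hij) hident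

/-- Recentering at the sample means instead of the true means costs a single product term. -/
theorem crossSum_eq (u z : ℕ → ℝ) (p q : ℝ) (n : ℕ) :
    crossSum u z n = ∑ i ∈ Finset.range n, (u i - p) * (z i - q)
      - n * ((avg u n - p) * (avg z n - q)) := by
  have e : ∀ i, (u i - avg u n) * (z i - avg z n) = (u i - p) * (z i - q)
      - u i * (avg z n - q) - z i * (avg u n - p) + (avg u n * avg z n - p * q) := by
    intro i; ring
  simp only [crossSum, e, Finset.sum_add_distrib, Finset.sum_sub_distrib, ← Finset.sum_mul,
    Finset.sum_const, Finset.card_range, nsmul_eq_mul]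
  rw [sum_eq_mul_avg u, sum_eq_mul_avg z]
  ring

theorem tendstoInDistribution_crossSum [IsProbabilityMeasure P] {u z : ℕ → Ω → ℝ}
    (hindep : iIndepFun (fun i ω => (u i ω, z i ω)) P)
    (hident : ∀ i, IdentDistrib (fun ω => (u i ω, z i ω)) (fun ω => (u 0 ω, z 0 ω)) P P)
    (hu : ∀ i ω, u i ω = 0 ∨ u i ω = 1) (hz : ∀ i ω, z i ω = 0 ∨ z i ω = 1)
    (huz : IndepFun (u 0) (z 0) P) {p q : ℝ} (hp : P[u 0] = p) (hq : P[z 0] = q)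
    (hp0 : 0 < p) (hp1 : p < 1) (hq0 : 0 < q) (hq1 : q < 1) :
    TendstoInDistribution (fun (n : ℕ) ω => (Real.sqrt n)⁻¹
      * crossSum (fun i => u i ω) (fun i => z i ω) n / Real.sqrt (p * (1 - p) * (q * (1 - q))))
      atTop (id : ℝ → ℝ) (fun _ => P) (gaussianReal 0 1) := by
  -- `s2` is the common variance of the products `(u i - p) * (z i - q)`.
  set s2 := p * (1 - p) * (q * (1 - q)) with hs2
  have hs : 0 < s2 := by
    have : 0 < 1 - p := by linarith
    have : 0 < 1 - q := by linarith
    positivity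
  set σ := Real.sqrt s2 with hσ
  have hσ0 : 0 < σ := Real.sqrt_pos.2 hs
  have hσ2 : σ ^ 2 = s2 := Real.sq_sqrt hs.le
  have hiu : ∀ i, IdentDistrib (u i) (u 0) P P := fun i => (hident i).comp measurable_fst
  have hiz : ∀ i, IdentDistrib (z i) (z 0) P P := fun i => (hident i).comp measurable_snd
  have hmu : ∀ i, AEMeasurable (u i) P := fun i => (hiu i).aemeasurable_fst
  have hmz : ∀ i, AEMeasurable (z i) P := fun i => (hiz i).aemeasurable_fst
  have hindu : iIndepFun u P := hindep.comp (fun _ => Prod.fst) fun _ => measurable_fst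
  have hindz : iIndepFun z P := hindep.comp (fun _ => Prod.snd) fun _ => measurable_snd
  have hφ : Measurable fun w : ℝ × ℝ => (w.1 - p) * (w.2 - q) / σ := by fun_prop
  have hup : ∫ ω, (u 0 ω - p) ∂P = 0 := by
    rw [integral_sub ((memLp_of_zero_or_one (hmu 0) (hu 0)).integrable (by norm_num))
      (integrable_const _), hp]
    simp
  have huq := integral_sub_mean_sq (hmu 0) (hu 0)
  have hzq := integral_sub_mean_sq (hmz 0) (hz 0)
  rw [hp] at huq
  rw [hq] at hzq
  have hclt := tendstoInDistribution_inv_sqrt_mul_sum (P := P) (P' := gaussianReal 0 1)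
    (X := fun i ω => (u i ω - p) * (z i ω - q) / σ) (Y := id) HasLaw.id
    (by
      have h := (huz.comp (φ := fun t => t - p) (ψ := fun t => t - q) (by fun_prop)
        (by fun_prop)).integral_fun_mul_eq_mul_integral
        ((hmu 0).sub_const p).aestronglyMeasurable ((hmz 0).sub_const q).aestronglyMeasurable
      simp only [Function.comp_apply] at h
      rw [integral_div, h, hup, zero_mul, zero_div])
    (by
      have h := (huz.comp (φ := fun t => (t - p) ^ 2) (ψ := fun t => (t - q) ^ 2) (by fun_prop)
        (by fun_prop)).integral_fun_mul_eq_mul_integral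
        (((hmu 0).sub_const p).pow_const 2).aestronglyMeasurable
        (((hmz 0).sub_const q).pow_const 2).aestronglyMeasurable
      simp only [Function.comp_apply] at h
      simp only [Pi.pow_apply, div_pow, mul_pow]
      rw [integral_div, h, huq, hzq, hσ2, ← hs2, div_self hs.ne'])
    (hindep.comp (fun _ w => (w.1 - p) * (w.2 - q) / σ) fun _ => hφ)
    (fun i => (hident i).comp hφ)
  -- The product of the deviations of the two sample means, divided by `σ`, is the remainder.
  have hrem := tendstoInMeasure_sqrt_mul_mul (P := P)
    (f := fun n ω => avg (fun i => u i ω) n - p)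
    (g := fun n ω => -(avg (fun i => z i ω) n - q) / σ)
    (memLp_avg_sub hmu hu p)
    (fun n => by
      simp only [div_eq_inv_mul]
      exact (memLp_avg_sub hmz hz q n).neg.const_mul σ⁻¹)
    (C := Var[u 0; P]) (D := Var[z 0; P] / σ ^ 2)
    (fun n hn => by
      have := integral_avg_sub_sq_le hindu hiu hu hn
      rwa [hp] at this)
    (fun n hn => by
      have := integral_avg_sub_sq_le hindz hiz hz hn
      rw [hq] at this
      simp only [div_pow, neg_sq]
      rw [integral_div, div_right_comm]
      gcongr)
  have hmrem : ∀ n : ℕ, AEMeasurable (fun ω => Real.sqrt n * ((avg (fun i => u i ω) n - p)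
      * (-(avg (fun i => z i ω) n - q) / σ))) P := fun n =>
    (((aemeasurable_avg hmu n).sub_const p).mul
      (((aemeasurable_avg hmz n).sub_const q).neg.div_const σ)).const_mul _
  have := hclt.add_of_tendstoInMeasure_const hrem hmrem
  refine this.congr (fun n => Eventually.of_forall fun ω => ?_)
    (Eventually.of_forall fun ω => by simp)
  simp only [Pi.add_apply]
  rw [crossSum_eq _ _ p q, ← Finset.sum_div]
  rcases eq_or_ne n 0 with rfl | hn
  · simp
  have hsn : Real.sqrt n ≠ 0 := by positivity
  have hsq : Real.sqrt n ^ 2 = n := Real.sq_sqrt (by positivity)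
  field_simp
  rw [hsq]
  ring

end Indicators

/-! ### The limit law -/

section

variable {Ω : Type*} [MeasurableSpace Ω] {P : Measure Ω}

theorem aemeasurable_modifiedMatrix {n : ℕ} {A : Ω → Matrix (Fin n) (Fin n) ℝ}
    (hA : ∀ i j, AEMeasurable (fun ω => A ω i j) P) (i j : Fin n) :
    AEMeasurable (fun ω => modifiedMatrix (A ω) i j) P := by
  simp only [modifiedMatrix, Matrix.of_apply]
  split_ifs
  · exact aemeasurable_const
  · fun_prop

theorem aemeasurable_dcov {n : ℕ} {A B : Ω → Matrix (Fin n) (Fin n) ℝ}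
    (hA : ∀ i j, AEMeasurable (fun ω => A ω i j) P)
    (hB : ∀ i j, AEMeasurable (fun ω => B ω i j) P) :
    AEMeasurable (fun ω => dcov (A ω) (B ω)) P := by
  have hA' := aemeasurable_modifiedMatrix hA
  have hB' := aemeasurable_modifiedMatrix hB
  simp only [dcov, Matrix.trace, Matrix.diag_apply, Matrix.mul_apply]
  fun_prop

theorem aemeasurable_distMatrix {E : Type*} [MeasurableSpace E] {d : E → E → ℝ}
    (hd : Measurable fun z : E × E => d z.1 z.2) {n : ℕ} {x : Fin n → Ω → E}
    (hx : ∀ i, AEMeasurable (x i) P) (i j : Fin n) :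
    AEMeasurable (fun ω => distMatrix d (fun i => x i ω) i j) P :=
  hd.comp_aemeasurable ((hx i).prodMk (hx j))

/-- Convergence in distribution depends on the limit variable only through its law. -/
theorem tendstoInDistribution_of_map_eq {ι E Ω' Ω'' : Type*} [MeasurableSpace E]
    [TopologicalSpace E] [OpensMeasurableSpace E] [MeasurableSpace Ω'] [MeasurableSpace Ω'']
    [IsProbabilityMeasure P] {P' : Measure Ω'} [IsProbabilityMeasure P'] {P'' : Measure Ω''}
    [IsProbabilityMeasure P''] {X : ι → Ω → E} {l : Filter ι} {Z : Ω' → E} {U : Ω'' → E}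
    (h : TendstoInDistribution X l Z (fun _ => P) P') (hU : AEMeasurable U P'')
    (hmap : P'.map Z = P''.map U) : TendstoInDistribution X l U (fun _ => P) P'' where
  forall_aemeasurable := h.forall_aemeasurable
  aemeasurable_limit := hU
  tendsto := by
    have e : (⟨P''.map U, Measure.isProbabilityMeasure_map hU⟩ : ProbabilityMeasure E)
        = ⟨P'.map Z, Measure.isProbabilityMeasure_map h.aemeasurable_limit⟩ :=
      Subtype.ext hmap.symm
    rw [e]
    exact h.tendsto

end

theorem centeredChiSquare_eq_map :
    centeredChiSquare = (gaussianReal 0 1).map (fun t => id t ^ 2 * 1 + -1) := by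
  rw [centeredChiSquare, chiSquareOne, Measure.map_map (by fun_prop) (by fun_prop)]
  congr 1
  ext t
  simp [sub_eq_add_neg]

open Classical in
/-- The indicator function of the point `a`. -/
noncomputable def pointIndicator {E : Type*} (a t : E) : ℝ := if t = a then 1 else 0

theorem pointIndicator_eq_zero_or_one {E : Type*} (a t : E) :
    pointIndicator a t = 0 ∨ pointIndicator a t = 1 := by
  unfold pointIndicator
  split_ifs <;> simp

theorem measurable_pointIndicator {E : Type*} [MeasurableSpace E] [MeasurableSingletonClass E]
    (a : E) : Measurable (pointIndicator a) :=
  Measurable.ite (measurableSet_singleton a) measurable_const measurable_const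

theorem integral_pointIndicator_mem_Ioo {Ω E : Type*} [MeasurableSpace Ω] {P : Measure Ω}
    [IsProbabilityMeasure P] [MeasurableSpace E] [MeasurableSingletonClass E] {X : Ω → E}
    (hX : AEMeasurable X P) {a b : E} (hab : a ≠ b) (ha : 0 < P {ω | X ω = a})
    (hb : 0 < P {ω | X ω = b}) :
    0 < ∫ ω, pointIndicator a (X ω) ∂P ∧ ∫ ω, pointIndicator a (X ω) ∂P < 1 := by
  have hm : AEMeasurable (fun ω => pointIndicator a (X ω)) P :=
    (measurable_pointIndicator a).comp_aemeasurable hX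
  have hint : Integrable (fun ω => pointIndicator a (X ω)) P :=
    (memLp_of_zero_or_one hm fun ω => pointIndicator_eq_zero_or_one a (X ω)).integrable
      (by norm_num)
  have h01 : ∀ ω, 0 ≤ pointIndicator a (X ω) ∧ 0 ≤ 1 - pointIndicator a (X ω) := fun ω => by
    rcases pointIndicator_eq_zero_or_one a (X ω) with h | h <;> simp [h]
  constructor
  · rw [integral_pos_iff_support_of_nonneg (fun ω => (h01 ω).1) hint]
    refine ha.trans_le (measure_mono fun ω hω => ?_)
    have hω' : X ω = a := hω
    simp [Function.mem_support, pointIndicator, hω']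
  · have : 0 < ∫ ω, (1 - pointIndicator a (X ω)) ∂P := by
      rw [integral_pos_iff_support_of_nonneg (fun ω => (h01 ω).2)
        ((integrable_const 1).sub hint)]
      refine hb.trans_le (measure_mono fun ω hω => ?_)
      have hω' : X ω = b := hω
      simp [Function.mem_support, pointIndicator, hω', hab.symm]
    rw [integral_sub (integrable_const 1) hint] at this
    simpa using this

theorem interaction_mul_pos {E F : Type*} [MeasurableSpace E] [MeasurableSingletonClass E]
    [MeasurableSpace F] [MeasurableSingletonClass F] {dX : E → E → ℝ} {dY : F → F → ℝ}
    (hd : (IsStrongNegativeTypeMetric dX ∧ IsStrongNegativeTypeMetric dY) ∨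
      (IsCharacteristicKernel dX ∧ IsCharacteristicKernel dY)) {a b : E} (hab : a ≠ b) {c e : F}
    (hce : c ≠ e) :
    0 < (dX a a + dX b b - 2 * dX a b) * (dY c c + dY e e - 2 * dY c e) := by
  rcases hd with ⟨hX, hY⟩ | ⟨hX, hY⟩
  · exact mul_pos_of_neg_of_neg (hX.interaction_neg hab) (hY.interaction_neg hce)
  · exact mul_pos (hX.interaction_pos hab) (hY.interaction_pos hce)

theorem pointIndicator_cases {E : Type*} {a b t : E} (hab : a ≠ b) (ht : t = a ∨ t = b) :
    t = a ∧ pointIndicator a t = 1 ∨ t = b ∧ pointIndicator a t = 0 := by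
  rcases ht with rfl | rfl
  · simp [pointIndicator]
  · simp [pointIndicator, hab.symm]

end DistCorr

open DistCorr Topology in
theorem mainTheorem6
    {E F : Type*} [MeasurableSpace E] [MeasurableSingletonClass E]
    [MeasurableSpace F] [MeasurableSingletonClass F]
    (dX : E → E → ℝ) (dY : F → F → ℝ)
    (hd : (DistCorr.IsStrongNegativeTypeMetric dX ∧ DistCorr.IsStrongNegativeTypeMetric dY) ∨
      (DistCorr.IsCharacteristicKernel dX ∧ DistCorr.IsCharacteristicKernel dY))
    {Ω₀ : Type*} [MeasurableSpace Ω₀] (P₀ : Measure Ω₀) [IsProbabilityMeasure P₀]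
    (X : Ω₀ → E) (Y : Ω₀ → F)
    (hXY : IndepFun X Y P₀)
    (hX : DistCorr.IsBinary X P₀) (hY : DistCorr.IsBinary Y P₀)
    {Ω : Type*} [MeasurableSpace Ω] (P : Measure Ω) [IsProbabilityMeasure P]
    (x : ℕ → Ω → E) (y : ℕ → Ω → F)
    (hindep : iIndepFun (fun i ω => (x i ω, y i ω)) P)
    (hident : ∀ i, IdentDistrib (fun ω => (x i ω, y i ω)) (fun ω => (X ω, Y ω)) P P₀)
    {Ω' : Type*} [MeasurableSpace Ω'] (P' : Measure Ω') [IsProbabilityMeasure P']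
    (U : Ω' → ℝ) (hU : HasLaw U DistCorr.centeredChiSquare P') :
    TendstoInDistribution
      (fun (n : ℕ) ω =>
        (n : ℝ) * DistCorr.dcor dX dY (fun i : Fin n => x i ω) (fun i : Fin n => y i ω))
      atTop U (fun _ => P) P' := by
  obtain ⟨a, b, hab, ha, hb, hXab⟩ := hX
  obtain ⟨c, e, hce, hc, he, hYce⟩ := hY
  have hGG := interaction_mul_pos hd hab hce
  obtain ⟨hmX, hsX, hmY, hsY⟩ : Measurable (fun z : E × E => dX z.1 z.2) ∧
      (∀ s t, dX s t = dX t s) ∧ Measurable (fun z : F × F => dY z.1 z.2) ∧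
      (∀ s t, dY s t = dY t s) := by
    rcases hd with ⟨h, h'⟩ | ⟨h, h'⟩ <;> exact ⟨h.measurable, h.symm, h'.measurable, h'.symm⟩
  have hix : ∀ i, IdentDistrib (x i) X P P₀ := fun i => (hident i).comp measurable_fst
  have hiy : ∀ i, IdentDistrib (y i) Y P P₀ := fun i => (hident i).comp measurable_snd
  have hmx : ∀ i, AEMeasurable (x i) P := fun i => (hix i).aemeasurable_fst
  have hmy : ∀ i, AEMeasurable (y i) P := fun i => (hiy i).aemeasurable_fst
  have hx : ∀ᵐ ω ∂P, ∀ i, x i ω = a ∨ x i ω = b := ae_all_iff.2 fun i =>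
    (hix i).symm.ae_snd ((measurableSet_singleton a).union (measurableSet_singleton b)) hXab
  have hy : ∀ᵐ ω ∂P, ∀ i, y i ω = c ∨ y i ω = e := ae_all_iff.2 fun i =>
    (hiy i).symm.ae_snd ((measurableSet_singleton c).union (measurableSet_singleton e)) hYce
  -- The indicators `u i` of `x i = a` and `z i` of `y i = c`.
  set u : ℕ → Ω → ℝ := fun i ω => pointIndicator a (x i ω)
  set z : ℕ → Ω → ℝ := fun i ω => pointIndicator c (y i ω)
  have hφ : Measurable fun w : E × F => (pointIndicator a w.1, pointIndicator c w.2) :=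
    ((measurable_pointIndicator a).comp measurable_fst).prodMk
      ((measurable_pointIndicator c).comp measurable_snd)
  have hu01 : ∀ i ω, u i ω = 0 ∨ u i ω = 1 := fun i ω => pointIndicator_eq_zero_or_one a (x i ω)
  have hz01 : ∀ i ω, z i ω = 0 ∨ z i ω = 1 := fun i ω => pointIndicator_eq_zero_or_one c (y i ω)
  have huzindep : iIndepFun (fun i ω => (u i ω, z i ω)) P := hindep.comp (fun _ => _) fun _ => hφ
  have huzident : ∀ i, IdentDistrib (fun ω => (u i ω, z i ω)) (fun ω => (u 0 ω, z 0 ω)) P P :=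
    fun i => ((hident i).trans (hident 0).symm).comp hφ
  have huz : IndepFun (u 0) (z 0) P :=
    (indepFun_of_identDistrib_pair hXY (hident 0).symm).comp (measurable_pointIndicator a)
      (measurable_pointIndicator c)
  have hmu : ∀ i, AEMeasurable (u i) P := fun i =>
    (measurable_pointIndicator a).comp_aemeasurable (hmx i)
  have hmz : ∀ i, AEMeasurable (z i) P := fun i =>
    (measurable_pointIndicator c).comp_aemeasurable (hmy i)
  obtain ⟨hp0, hp1⟩ : 0 < P[u 0] ∧ P[u 0] < 1 := by
    have h := ((hix 0).comp (measurable_pointIndicator a)).integral_eq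
    have h' := integral_pointIndicator_mem_Ioo (hix 0).aemeasurable_snd hab ha hb
    simp only [Function.comp_apply] at h
    rwa [← h] at h'
  obtain ⟨hq0, hq1⟩ : 0 < P[z 0] ∧ P[z 0] < 1 := by
    have h := ((hiy 0).comp (measurable_pointIndicator c)).integral_eq
    have h' := integral_pointIndicator_mem_Ioo (hiy 0).aemeasurable_snd hce hc he
    simp only [Function.comp_apply] at h
    rwa [← h] at h'
  have hclt := tendstoInDistribution_crossSum huzindep huzident hu01 hz01 huz rfl rfl hp0 hp1
    hq0 hq1
  have hpq : ∫ ω, u 0 ω * z 0 ω ∂P = P[u 0] * P[z 0] :=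
    huz.integral_fun_mul_eq_mul_integral (hmu 0).aestronglyMeasurable (hmz 0).aestronglyMeasurable
  have hlimp := ae_tendsto_avg (X := u) (huzindep.comp (fun _ => Prod.fst) fun _ => measurable_fst)
    (fun i => (huzident i).comp measurable_fst)
    ((memLp_of_zero_or_one (hmu 0) (hu01 0)).integrable (by norm_num))
  have hlimq := ae_tendsto_avg (X := z) (huzindep.comp (fun _ => Prod.snd) fun _ => measurable_snd)
    (fun i => (huzident i).comp measurable_snd)
    ((memLp_of_zero_or_one (hmz 0) (hz01 0)).integrable (by norm_num))
  have hmul : Measurable fun w : ℝ × ℝ => w.1 * w.2 := by fun_prop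
  have hlimpq := ae_tendsto_avg (X := fun i ω => u i ω * z i ω)
    (huzindep.comp (fun _ w => w.1 * w.2) fun _ => hmul)
    (fun i => (huzident i).comp hmul)
    ((memLp_of_zero_or_one ((hmu 0).mul (hmz 0)) fun ω => by
      rcases hu01 0 ω with h | h <;> simp [h, hz01 0 ω]).integrable (by norm_num))
  rw [hpq] at hlimpq
  set p := P[u 0]
  set q := P[z 0]
  -- The statistic is `T = W² R + (T - W² R)`, where `W` obeys the central limit theorem, while the
  -- factor `R` and the remainder converge almost surely to constants.
  set DX : ℕ → Ω → ℝ := fun n ω => dcov (distMatrix dX fun i : Fin n => x i ω)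
    (distMatrix dX fun i : Fin n => x i ω) with hDX
  set DY : ℕ → Ω → ℝ := fun n ω => dcov (distMatrix dY fun i : Fin n => y i ω)
    (distMatrix dY fun i : Fin n => y i ω) with hDY
  set DXY : ℕ → Ω → ℝ := fun n ω => dcov (distMatrix dX fun i : Fin n => x i ω)
    (distMatrix dY fun i : Fin n => y i ω) with hDXY
  set W : ℕ → Ω → ℝ := fun n ω => (Real.sqrt n)⁻¹ * crossSum (fun i => u i ω) (fun i => z i ω) n
    / Real.sqrt (p * (1 - p) * (q * (1 - q)))
  set T : ℕ → Ω → ℝ := fun n ω =>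
    n * dcor dX dY (fun i : Fin n => x i ω) (fun i : Fin n => y i ω) with hT
  set R : ℕ → Ω → ℝ := fun n ω => (n : ℝ) / (n - 3)
    * ((dX a a + dX b b - 2 * dX a b) * (dY c c + dY e e - 2 * dY c e)
      * (p * (1 - p) * (q * (1 - q)))) / Real.sqrt (DX n ω * DY n ω)
  have hmDX : ∀ n, AEMeasurable (DX n) P := fun n =>
    aemeasurable_dcov (aemeasurable_distMatrix hmX fun i => hmx i)
      (aemeasurable_distMatrix hmX fun i => hmx i)
  have hmDY : ∀ n, AEMeasurable (DY n) P := fun n =>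
    aemeasurable_dcov (aemeasurable_distMatrix hmY fun i => hmy i)
      (aemeasurable_distMatrix hmY fun i => hmy i)
  have hmDXY : ∀ n, AEMeasurable (DXY n) P := fun n =>
    aemeasurable_dcov (aemeasurable_distMatrix hmX fun i => hmx i)
      (aemeasurable_distMatrix hmY fun i => hmy i)
  have hmW : ∀ n, AEMeasurable (W n) P := hclt.forall_aemeasurable
  have hmR : ∀ n, AEMeasurable (R n) P := fun n =>
    (((hmDX n).mul (hmDY n)).sqrt).const_div _
  have hmT : ∀ n, AEMeasurable (T n) P := by
    intro n
    by_cases hn : 4 ≤ n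
    · simp only [hT, dcor_eq dX dY hn]
      exact ((hmDXY n).div ((hmDX n).mul (hmDY n)).sqrt).const_mul _
    · simp only [hT, dcor, hn, false_and, if_false]
      exact aemeasurable_const
  have hlim : ∀ᵐ ω ∂P, Tendsto (fun n => R n ω) atTop (𝓝 1) ∧
      Tendsto (fun n => T n ω - W n ω ^ 2 * R n ω) atTop (𝓝 (-1)) := by
    filter_upwards [hx, hy, hlimp, hlimq, hlimpq] with ω hxω hyω h1 h2 h3
    have ex : ∀ n, distMatrix dX (fun i : Fin n => x i ω) = _ := fun n =>
      distMatrix_eq_biaffineMatrix hsX fun i => pointIndicator_cases hab (hxω i)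
    have ey : ∀ n, distMatrix dY (fun i : Fin n => y i ω) = _ := fun n =>
      distMatrix_eq_biaffineMatrix hsY fun i => pointIndicator_cases hce (hyω i)
    have hdec := tendsto_dcor_decomposition hGG (fun i => hu01 i ω) (fun i => hz01 i ω) hp0 hp1
      hq0 hq1 h1 h2 h3 (DX := fun n => DX n ω) (DY := fun n => DY n ω) (DXY := fun n => DXY n ω)
      (fun n => by simp only [hDX, ex]; rfl) (fun n => by simp only [hDY, ey]; rfl)
      (fun n => by simp only [hDXY, ex, ey]; rfl)
    refine ⟨hdec.1, hdec.2.congr' ?_⟩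
    filter_upwards [eventually_ge_atTop 4] with n hn
    simp only [hT, dcor_eq dX dY hn]
    rfl
  have hR : TendstoInMeasure P R atTop fun _ => 1 :=
    tendstoInMeasure_of_tendsto_ae (fun n => (hmR n).aestronglyMeasurable)
      (hlim.mono fun _ h => h.1)
  have hmrest : ∀ n, AEMeasurable (fun ω => T n ω - W n ω ^ 2 * R n ω) P := fun n =>
    (hmT n).sub (((hmW n).pow_const 2).mul (hmR n))
  have hrest : TendstoInMeasure P (fun n ω => T n ω - W n ω ^ 2 * R n ω) atTop fun _ => -1 :=
    tendstoInMeasure_of_tendsto_ae (fun n => (hmrest n).aestronglyMeasurable)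
      (hlim.mono fun _ h => h.2)
  -- Slutsky's theorem, first for the factor `R`, then for the remainder.
  have hWR := hclt.continuous_comp_prodMk_of_tendstoInMeasure_const
    (g := fun w : ℝ × ℝ => w.1 ^ 2 * w.2) (by fun_prop) hR hmR
  have hTlim := (hWR.add_of_tendstoInMeasure_const hrest hmrest).congr (Y := T)
    (fun n => Eventually.of_forall fun ω => by simp [W]) Filter.EventuallyEq.rfl
  refine tendstoInDistribution_of_map_eq hTlim hU.aemeasurable ?_
  rw [hU.map_eq, centeredChiSquare_eq_map]
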